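/- Let $F$ be a CM field, i.e. a number field that is a totally imaginary quadratic extension of a totally real field. Let $\Sigma_F$ be the set of field embeddings $\tau : F \to \mathbb{C}$, and write $\bar\tau$ for the composite of $\tau$ with complex conjugation. Let $\mathsf{w} \in \mathbb{Z}$ and let $\mathbf{n} = (n_\tau)_{\tau \in \Sigma_F}$ be a family of integers with $n_\tau + n_{\bar\tau} = \mathsf{w}$ for all $\tau \in \Sigma_F$. Then there exists an algebraic Hecke character of $F$, of some modulus, with infinity type $\mathbf{n}$. Explicitly: let $\mathbb{I}_F$ be the group of id\`eles of $F$ and $F_\infty^\times = \prod_{w \mid \infty} F_w^\times$. Then there exist a nonzero integral ideal $\mathfrak{m} = \prod_{\mathfrak p} \mathfrak{p}^{m_{\mathfrak p}}$ of $F$ and a continuous homomorphism (not required to be unitary) $\chi : \mathbb{I}_F/F^\times \to \mathbb{C}^\times$ such that 1. $\chi$ has modulus $\mathfrak{m}$: it is trivial on the id\`eles that are $1$ at every infinite place, lie in $1 + \mathfrak{p}^{m_{\mathfrak p}}\mathcal{O}_{\mathfrak p}$ at every prime $\mathfrak{p} \mid \mathfrak{m}$, and are units at every finite prime $\mathfrak{p}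 \nmid \mathfrak{m}$; 2. $\chi$ is algebraic with infinity type $\mathbf{n}$: for every $x = (x_w)_w \in F_\infty^\times \subset \mathbb{I}_F$, $$\chi(x) = \prod_{w \mid \infty} z_w^{\,n_{\tau_w}} \, \bar z_w^{\; n_{\bar\tau_w}},$$ where, for each (necessarily complex) infinite place $w$, $\{\tau_w, \bar\tau_w\}$ is the pair of conjugate embeddings defining $w$ and $z_w \in \mathbb{C}^\times$ is the image of $x_w$ under the isomorphism $F_w \simeq \mathbb{C}$ induced by $\tau_w$ (the product does not depend on the choice of $\tau_w$ in each pair). -/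

import Mathlib

namespace HeckeChar

open NumberField IsDedekindDomain ComplexConjugate

noncomputable section

/-- The idèle group `𝕀_F = 𝔸_Fˣ`, with the topology of the unit group of the adèle ring. -/
abbrev Ideles (F : Type*) [Field F] [NumberField F] : Type _ := (AdeleRing (𝓞 F) F)ˣ

/-- `Fˣ`, diagonally embedded in the idèles. -/
def principalIdeles (F : Type*) [Field F] [NumberField F] : Subgroup (Ideles F) :=
  (Units.map (algebraMap F (AdeleRing (𝓞 F) F)).toMonoidHom).range

/-- The idèle class group `𝕀_F / Fˣ`, with the quotient topology. -/
abbrev IdeleClassGroup (F : Type*) [Field F] [NumberField F] : Type _ :=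
  Ideles F ⧸ principalIdeles F

/-- A Hecke character of `F`: a continuous homomorphism `𝕀_F / Fˣ → ℂˣ`
(not required to be unitary). -/
abbrev HeckeCharacter (F : Type*) [Field F] [NumberField F] : Type _ :=
  IdeleClassGroup F →ₜ* ℂˣ

/-- The inclusion `F_∞ˣ → 𝕀_F`, `x ↦ (x; 1, 1, …)`. -/
def infiniteIncl (F : Type*) [Field F] [NumberField F] : (InfiniteAdeleRing F)ˣ →* Ideles F :=
  Units.map (MonoidHom.inl (InfiniteAdeleRing F) (FiniteAdeleRing (𝓞 F) F))

/-- The character at infinity `χ_∞ : F_∞ˣ → ℂˣ` of a Hecke character. -/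
def HeckeCharacter.atInfinity {F : Type*} [Field F] [NumberField F] (χ : HeckeCharacter F) :
    (InfiniteAdeleRing F)ˣ →* ℂˣ :=
  (χ.toMonoidHom.comp (QuotientGroup.mk' (principalIdeles F))).comp (infiniteIncl F)

open Classical in
/-- `χ` is an algebraic Hecke character of infinity type `n = (n_τ)`, `τ : F → ℂ`:
`χ_∞(x) = ∏_{v real} x_v ^ n_{τ_v} · ∏_{w complex} z_w ^ n_{τ_w} · (conj z_w) ^ n_{conj τ_w}`.
Here `z_w` is the image of `x_w` under `F_w ≃ ℂ` induced by the chosen `τ_w = w.embedding`; the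
factor at `w` does not depend on that choice within the conjugate pair. -/
def HeckeCharacter.HasInfinityType {F : Type*} [Field F] [NumberField F]
    (χ : HeckeCharacter F) (n : (F →+* ℂ) → ℤ) : Prop :=
  ∀ x : (InfiniteAdeleRing F)ˣ,
    (χ.atInfinity x : ℂ) =
      (∏ v : {v : InfinitePlace F // v.IsReal},
        ((InfinitePlace.Completion.extensionEmbeddingOfIsReal v.2 (x.val v.1) : ℝ) : ℂ) ^
          n v.1.embedding) *
      ∏ w : {w : InfinitePlace F // w.IsComplex},
        (InfinitePlace.Completion.extensionEmbedding w.1 (x.val w.1)) ^ n w.1.embedding *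
          (conj (InfinitePlace.Completion.extensionEmbedding w.1 (x.val w.1))) ^
            n (ComplexEmbedding.conjugate w.1.embedding)

open Classical in
/-- The exponent `m_𝔭` of the prime `𝔭` in the factorisation of a nonzero integral ideal `𝔪`. -/
def exponentAt {F : Type*} [Field F] [NumberField F] (𝔪 : Ideal (𝓞 F))
    (𝔭 : HeightOneSpectrum (𝓞 F)) : ℕ :=
  (Associates.mk 𝔭.asIdeal).count (Associates.mk 𝔪).factors

/-- `𝕌_{F,f}(𝔪)`: idèles that are `1` at every infinite place and, at every finite prime `𝔭`, are
a unit congruent to `1` modulo `𝔭 ^ m_𝔭` (so `1 + 𝔭 ^ m_𝔭` if `𝔭 ∣ 𝔪`, all units otherwise). -/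
def finiteCongruenceIdeles {F : Type*} [Field F] [NumberField F] (𝔪 : Ideal (𝓞 F)) :
    Set (Ideles F) :=
  {u | u.val.1 = 1 ∧ ∀ 𝔭 : HeightOneSpectrum (𝓞 F),
    Valued.v (u.val.2 𝔭) = 1 ∧
      Valued.v (u.val.2 𝔭 - 1) ≤ WithZero.exp (-(exponentAt 𝔪 𝔭 : ℤ))}

/-- `χ` is a Hecke character mod `𝔪`: it is trivial on `𝕌_{F,f}(𝔪)`. -/
def HeckeCharacter.HasModulus {F : Type*} [Field F] [NumberField F]
    (χ : HeckeCharacter F) (𝔪 : Ideal (𝓞 F)) : Prop :=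
  ∀ u ∈ finiteCongruenceIdeles 𝔪, χ (QuotientGroup.mk u) = 1

end

end HeckeChar

open NumberField IsDedekindDomain ComplexConjugate

/-! The modulus 3 works for every infinity type. Let `H` be the open subgroup of idèles that are
units congruent to 1 modulo 3 at all finite primes and arbitrary at infinity. The prescribed
character of the infinite part is defined on `H`, and it descends to the idèle classes as soon as it
kills `H ∩ Fˣ`, the units `u ≡ 1 mod 3`. For such `u`, the quotient of `u` by its complex conjugate
is a root of unity congruent to 1 modulo 3, hence 1. So `u` is real and the character takes the
value `P ^ w`, with `P` the product of `u` over one embedding per place. Then `P ^ 2` is the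
absolute norm 1 and `P ≡ 1 mod 3`, so `P = 1` (`infinityTypeCharacter_eq_one`). Since `ℂˣ` is
divisible, the character extends to all idèle classes; continuity is automatic because `H` is open
(`exists_heckeCharacter_eqOn`). -/

/-- `f` factors through `H ⧸ (H ∩ K)`, which embeds in `A ⧸ K`; a divisible abelian group is
injective, by Baer's criterion. -/
theorem MonoidHom.exists_extension_of_rootable {A D : Type*} [CommGroup A] [CommGroup D]
    [RootableBy D ℤ] (H K : Subgroup A) (f : A →* D) (hf : ∀ a ∈ H, a ∈ K → f a = 1) :
    ∃ g : A ⧸ K →* D, ∀ a ∈ H, g (QuotientGroup.mk a) = f a := by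
  let i : H →* A ⧸ K := (QuotientGroup.mk' K).comp H.subtype
  have hker : ∀ a ∈ i.ker, (f.comp H.subtype) a = 1 := fun a ha ↦
    hf a a.2 ((QuotientGroup.eq_one_iff _).1 ha)
  let j : H ⧸ i.ker →* A ⧸ K := QuotientGroup.kerLift i
  let φ : H ⧸ i.ker →* D := QuotientGroup.lift i.ker (f.comp H.subtype) hker
  let _ : DivisibleBy (Additive D) ℤ :=
    { div := fun a n ↦ Additive.ofMul (RootableBy.root a.toMul n)
      div_zero := fun a ↦ congrArg Additive.ofMul (RootableBy.root_zero a.toMul)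
      div_cancel := fun {n} a hn ↦
        congrArg Additive.ofMul (RootableBy.root_cancel (α := ℤ) a.toMul hn) }
  obtain ⟨g, hg⟩ := (Module.Baer.of_divisible (Additive D)).extension_property_addMonoidHom
    (MonoidHom.toAdditive j) (QuotientGroup.kerLift_injective i) (MonoidHom.toAdditive φ)
  refine ⟨MonoidHom.toAdditive.symm g, fun a ha ↦ ?_⟩
  exact DFunLike.congr_fun hg (Additive.ofMul (QuotientGroup.mk (⟨a, ha⟩ : H)))

noncomputable instance Complex.unitsRootableBy : RootableBy ℂˣ ℤ :=
  letI : RootableBy ℂˣ ℕ := rootableByOfPowLeftSurj _ _ fun {n} hn z ↦ by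
    obtain ⟨x, hx⟩ := IsAlgClosed.exists_pow_nat_eq (z : ℂ) (Nat.pos_of_ne_zero hn)
    have hx0 : x ≠ 0 := by
      rintro rfl
      exact z.ne_zero (by rw [← hx, zero_pow hn])
    exact ⟨Units.mk0 x hx0, Units.ext hx⟩
  Group.rootableByIntOfRootableByNat _

/-! ### Units congruent to 1 modulo 3 -/

namespace NumberField

/-- Every absolute value of `ζ - 1` is at most 2, so those of `c` are at most 2/3; a nonzero
algebraic integer cannot be that small at all places. -/
theorem Units.eq_one_of_mem_torsion_of_sub_one_eq {F : Type*} [Field F] [NumberField F]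
    {ζ : (𝓞 F)ˣ} (hζ : ζ ∈ Units.torsion F) {c : 𝓞 F} (hc : (ζ : 𝓞 F) - 1 = 3 * c) : ζ = 1 := by
  have key : ∀ w : InfinitePlace F, w c < 1 := fun w ↦ by
    have h1 : w (3 * c : F) ≤ 2 := by
      have h : (3 * c : F) = (ζ : F) - 1 := by
        have := congrArg (algebraMap (𝓞 F) F) hc
        rw [map_sub, map_mul, map_one, map_ofNat] at this
        exact this.symm
      rw [h, ← InfinitePlace.norm_embedding_eq, map_sub, map_one]
      refine (norm_sub_le _ _).trans ?_
      rw [InfinitePlace.norm_embedding_eq, (Units.mem_torsion F).1 hζ w]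
      norm_num
    have h3 : w (3 : F) = 3 := by
      rw [← InfinitePlace.norm_embedding_eq, map_ofNat]; simp
    rw [map_mul, h3] at h1
    linarith
  have hc0 : c = 0 := by
    by_contra h
    obtain ⟨w⟩ := (inferInstance : Nonempty (InfinitePlace F))
    exact (key w).not_ge (InfinitePlace.one_le_of_lt_one h fun z _ ↦ key z)
  rw [hc0, mul_zero, sub_eq_zero] at hc
  exact Units.ext hc

theorem IsCMField.unitsComplexConj_eq_self_of_sub_one_eq {F : Type*} [Field F] [NumberField F]
    [IsCMField F] {u : (𝓞 F)ˣ} {b : 𝓞 F} (hb : (u : 𝓞 F) - 1 = 3 * b) :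
    unitsComplexConj F u = u := by
  have h : unitsMulComplexConjInv F u = (1 : (𝓞 F)ˣ) := by
    refine Units.eq_one_of_mem_torsion_of_sub_one_eq (SetLike.coe_mem _)
      (c := (b - ringOfIntegersComplexConj F b) * ↑(unitsComplexConj F u)⁻¹) ?_
    have hb' := congrArg (ringOfIntegersComplexConj F) hb
    rw [map_sub, map_one, map_mul, map_ofNat] at hb'
    have hu : ((unitsComplexConj F u : (𝓞 F)ˣ) : 𝓞 F) = ringOfIntegersComplexConj F u := rfl
    have hi := (unitsComplexConj F u).mul_inv
    rw [unitsMulComplexConjInv_apply, Units.val_mul]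
    rw [hu] at hi
    linear_combination hi + ↑(unitsComplexConj F u)⁻¹ * (hb - hb')
  rw [unitsMulComplexConjInv_apply, mul_inv_eq_one] at h
  exact h.symm

/-- The chosen embeddings differ from place to place, so the congruence is carried out among the
algebraic integers of `ℂ`. -/
theorem InfinitePlace.exists_prod_embedding_eq_one_add {F : Type*} [Field F] [NumberField F]
    {a b : 𝓞 F} (hb : a - 1 = 3 * b) (s : Finset (InfinitePlace F)) :
    ∃ c : ℂ, IsIntegral ℤ c ∧ ∏ w ∈ s, w.embedding a = 1 + 3 * c := by
  classical
  induction s using Finset.induction_on with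
  | empty => exact ⟨0, isIntegral_zero, by simp⟩
  | insert w s hw ih =>
    obtain ⟨c, hc, h⟩ := ih
    have hβ : IsIntegral ℤ (w.embedding b) := b.isIntegral_coe.map w.embedding.toIntAlgHom
    have ha : w.embedding a = 1 + 3 * w.embedding b := by
      have := congrArg (fun x : 𝓞 F ↦ w.embedding x) hb
      simp only [map_sub, map_mul, map_one, map_ofNat] at this
      linear_combination this
    refine ⟨w.embedding b + c + 3 * (w.embedding b * c),
      (hβ.add hc).add ((isIntegral_algebraMap (R := ℤ) (x := 3)).mul (hβ.mul hc)), ?_⟩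
    rw [Finset.prod_insert hw, h, ha]
    ring

theorem IsCMField.conj_embedding_eq_self_of_sub_one_eq {F : Type*} [Field F] [NumberField F]
    [IsCMField F] {u : (𝓞 F)ˣ} {b : 𝓞 F} (hb : (u : 𝓞 F) - 1 = 3 * b) (τ : F →+* ℂ) :
    conj (τ u) = τ u := by
  rw [← complexEmbedding_complexConj]
  exact congrArg (fun x : (𝓞 F)ˣ ↦ τ x) (unitsComplexConj_eq_self_of_sub_one_eq hb)

theorem IsCMField.prod_embedding_eq_one_of_sub_one_eq {F : Type*} [Field F] [NumberField F]
    [IsCMField F] {u : (𝓞 F)ˣ} {b : 𝓞 F} (hb : (u : 𝓞 F) - 1 = 3 * b) :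
    ∏ w : InfinitePlace F, w.embedding u = 1 := by
  set P := ∏ w : InfinitePlace F, w.embedding u with hP
  have hsq : P ^ 2 = 1 := by
    have h1 : P ^ 2 = ((∏ w : InfinitePlace F, w (u : F) ^ w.mult : ℝ) : ℂ) := by
      rw [hP, ← Finset.prod_pow, Complex.ofReal_prod]
      refine Finset.prod_congr rfl fun w _ ↦ ?_
      rw [InfinitePlace.mult_isComplex ⟨w, IsTotallyComplex.isComplex w⟩,
        ← InfinitePlace.norm_embedding_eq, Complex.ofReal_pow, ← Complex.mul_conj', sq,
        conj_embedding_eq_self_of_sub_one_eq hb]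
    rw [h1, InfinitePlace.prod_eq_abs_norm, ← Units.coe_coe, Units.norm]
    simp
  rcases (sq_eq_sq_iff_eq_or_eq_neg.1 (hsq.trans (one_pow 2).symm)) with h | h
  · exact h
  · exfalso
    obtain ⟨c, hc, h'⟩ := InfinitePlace.exists_prod_embedding_eq_one_add hb Finset.univ
    -- `P = -1 = 1 + 3c` would make -2/3 an algebraic integer.
    have hc' : c = algebraMap ℚ ℂ (-2 / 3) := by
      simp only [eq_ratCast]; push_cast
      linear_combination (h - h') / 3
    rw [hc', isIntegral_algebraMap_iff (algebraMap ℚ ℂ).injective,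
      IsIntegrallyClosed.isIntegral_iff] at hc
    obtain ⟨y, hy⟩ := hc
    have : (3 * y : ℚ) = -2 := by simp only [eq_intCast] at hy; rw [hy]; norm_num
    have : 3 * y = -2 := by exact_mod_cast this
    omega

end NumberField

/-! ### The character at infinity -/

namespace HeckeChar

noncomputable section

variable {F : Type*} [Field F]

/-- The map `F_∞ˣ → ℂˣ` induced by the extension of `w.embedding` to `F_w`. -/
def infiniteEmbedding (w : InfinitePlace F) : (InfiniteAdeleRing F)ˣ →* ℂˣ :=
  Units.map ((InfinitePlace.Completion.extensionEmbedding w).toMonoidHom.comp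
    (Pi.evalMonoidHom (fun v : InfinitePlace F ↦ v.Completion) w))

@[simp]
theorem infiniteEmbedding_apply (w : InfinitePlace F) (x : (InfiniteAdeleRing F)ˣ) :
    (infiniteEmbedding w x : ℂ) = InfinitePlace.Completion.extensionEmbedding w (x.val w) := rfl

theorem continuous_infiniteEmbedding (w : InfinitePlace F) :
    Continuous (infiniteEmbedding w) :=
  Continuous.units_map _ ((InfinitePlace.Completion.isometry_extensionEmbedding w).continuous.comp
    (continuous_apply (A := fun v : InfinitePlace F ↦ v.Completion) w))

variable [NumberField F]

open Classical in
/-- The character `∏ z_w ^ n_{τ_w} (conj z_w) ^ n_{conj τ_w}` of `F_∞ˣ`, over the complex places. -/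
def infinityTypeCharacter (n : (F →+* ℂ) → ℤ) : (InfiniteAdeleRing F)ˣ →* ℂˣ :=
  ∏ w : {w : InfinitePlace F // w.IsComplex},
    infiniteEmbedding w.1 ^ n w.1.embedding *
      ((Units.map (starRingEnd ℂ).toMonoidHom).comp (infiniteEmbedding w.1)) ^
        n (ComplexEmbedding.conjugate w.1.embedding)

open Classical in
theorem infinityTypeCharacter_apply (n : (F →+* ℂ) → ℤ) (x : (InfiniteAdeleRing F)ˣ) :
    (infinityTypeCharacter n x : ℂ) = ∏ w : {w : InfinitePlace F // w.IsComplex},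
      (InfinitePlace.Completion.extensionEmbedding w.1 (x.val w.1)) ^ n w.1.embedding *
        (conj (InfinitePlace.Completion.extensionEmbedding w.1 (x.val w.1))) ^
          n (ComplexEmbedding.conjugate w.1.embedding) := by
  simp [infinityTypeCharacter, MonoidHom.finsetProd_apply]

open Classical in
theorem continuous_infinityTypeCharacter (n : (F →+* ℂ) → ℤ) :
    Continuous (infinityTypeCharacter n) := by
  have h : (infinityTypeCharacter n : (InfiniteAdeleRing F)ˣ → ℂˣ) = fun x ↦
      ∏ w : {w : InfinitePlace F // w.IsComplex}, infiniteEmbedding w.1 x ^ n w.1.embedding *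
        (Units.map (starRingEnd ℂ).toMonoidHom (infiniteEmbedding w.1 x)) ^
          n (ComplexEmbedding.conjugate w.1.embedding) := by
    ext x
    simp [infinityTypeCharacter, MonoidHom.finsetProd_apply]
  rw [h]
  refine continuous_finsetProd _ fun w _ ↦ ?_
  exact ((continuous_infiniteEmbedding w.1).zpow _).mul
    (((Continuous.units_map _ Complex.continuous_conj).comp
      (continuous_infiniteEmbedding w.1)).zpow _)

/-- As `u` is real in every embedding, the two factors at each place merge into a `k`-th power, `k`
being independent of the place. -/
theorem infinityTypeCharacter_eq_one [IsCMField F] {n : (F →+* ℂ) → ℤ} {k : ℤ}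
    (hn : ∀ τ : F →+* ℂ, n τ + n (ComplexEmbedding.conjugate τ) = k)
    {u : (𝓞 F)ˣ} {b : 𝓞 F} (hb : (u : 𝓞 F) - 1 = 3 * b) {x : (InfiniteAdeleRing F)ˣ}
    (hx : x.val = algebraMap F (InfiniteAdeleRing F) u) : infinityTypeCharacter n x = 1 := by
  classical
  have hu (τ : F →+* ℂ) : τ (u : F) ≠ 0 := by simp
  have he (w : InfinitePlace F) :
      InfinitePlace.Completion.extensionEmbedding w (x.val w) = w.embedding (u : F) := by
    rw [hx]
    exact InfinitePlace.Completion.extensionEmbedding_coe w _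
  ext
  rw [infinityTypeCharacter_apply]
  simp_rw [he, IsCMField.conj_embedding_eq_self_of_sub_one_eq hb, ← zpow_add₀ (hu _), hn]
  rw [Finset.prod_zpow, Units.val_one]
  have hP := IsCMField.prod_embedding_eq_one_of_sub_one_eq hb
  rw [← (Equiv.subtypeUnivEquiv (p := InfinitePlace.IsComplex (K := F))
    IsTotallyComplex.isComplex).prod_comp] at hP
  simp only [Equiv.subtypeUnivEquiv_apply] at hP
  rw [hP, one_zpow]

/-- The projection `𝕀_F → F_∞ˣ`. -/
def infinitePart : Ideles F →* (InfiniteAdeleRing F)ˣ :=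
  Units.map (MonoidHom.fst (InfiniteAdeleRing F) (FiniteAdeleRing (𝓞 F) F))

theorem continuous_infinitePart : Continuous (infinitePart (F := F)) :=
  Continuous.units_map _ (continuous_fst (X := InfiniteAdeleRing F))

/-! ### Congruence subgroups of the idèles -/

/-- The idèles whose component at every finite prime is a unit congruent to `1` modulo `N`. -/
def congruenceSubgroup (F : Type*) [Field F] [NumberField F] (N : 𝓞 F) :
    Subgroup (Ideles F) where
  carrier := {u | ∀ 𝔭 : HeightOneSpectrum (𝓞 F), Valued.v (u.val.2 𝔭) = 1 ∧
    Valued.v (u.val.2 𝔭 - 1) ≤ 𝔭.intValuation N}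
  one_mem' 𝔭 := by
    have h : (1 : Ideles F).val.2 𝔭 = 1 := rfl
    rw [h]
    simp
  mul_mem' {a b} ha hb 𝔭 := by
    have h : (a * b).val.2 𝔭 = a.val.2 𝔭 * b.val.2 𝔭 := rfl
    refine ⟨by rw [h, map_mul, (ha 𝔭).1, (hb 𝔭).1, one_mul], ?_⟩
    rw [h, show a.val.2 𝔭 * b.val.2 𝔭 - 1 =
      a.val.2 𝔭 * (b.val.2 𝔭 - 1) + (a.val.2 𝔭 - 1) by ring]
    refine Valuation.map_add_le _ ?_ (ha 𝔭).2
    rw [map_mul, (ha 𝔭).1, one_mul]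
    exact (hb 𝔭).2
  inv_mem' {a} ha 𝔭 := by
    have h : a.val.2 𝔭 * (a⁻¹).val.2 𝔭 = 1 :=
      congrArg (fun x : AdeleRing (𝓞 F) F ↦ x.2 𝔭) a.mul_inv
    have h1 : Valued.v ((a⁻¹).val.2 𝔭) = 1 := by
      have := congrArg Valued.v h
      rwa [map_mul, (ha 𝔭).1, one_mul, map_one] at this
    refine ⟨h1, ?_⟩
    rw [show (a⁻¹).val.2 𝔭 - 1 = -((a⁻¹).val.2 𝔭 * (a.val.2 𝔭 - 1)) by linear_combination h,
      Valuation.map_neg, map_mul, h1, one_mul]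
    exact (ha 𝔭).2

theorem isOpen_integralFiniteAdeles :
    IsOpen {x : FiniteAdeleRing (𝓞 F) F |
      ∀ 𝔭 : HeightOneSpectrum (𝓞 F), Valued.v (x 𝔭) ≤ 1} := by
  have h := RestrictedProduct.isOpen_forall_mem
    (A := fun 𝔭 : HeightOneSpectrum (𝓞 F) ↦
      (𝔭.adicCompletionIntegers F : Set (𝔭.adicCompletion F)))
    fun 𝔭 ↦ Valued.isOpen_valuationSubring (𝔭.adicCompletion F)
  exact h

theorem isOpen_congruenceSubgroup {N : 𝓞 F} (hN : N ≠ 0) :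
    IsOpen (congruenceSubgroup F N : Set (Ideles F)) := by
  -- Multiplying by `N⁻¹` turns the congruence into integrality, so all conditions are preimages of
  -- the open set of integral finite adèles.
  let c : FiniteAdeleRing (𝓞 F) F := algebraMap F _ (N : F)⁻¹
  have hfin : Continuous fun u : Ideles F ↦ u.val.2 :=
    (continuous_snd (X := InfiniteAdeleRing F) (Y := FiniteAdeleRing (𝓞 F) F)).comp
      Units.continuous_val
  have hinv : Continuous fun u : Ideles F ↦ (u⁻¹).val.2 := hfin.comp continuous_inv
  have hO := isOpen_integralFiniteAdeles (F := F)
  convert ((hO.preimage hfin).inter (hO.preimage hinv)).inter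
    (hO.preimage (continuous_const.mul (hfin.sub continuous_const) :
      Continuous fun u : Ideles F ↦ c * (u.val.2 - 1))) using 1
  ext u
  have hcong (𝔭 : HeightOneSpectrum (𝓞 F)) : Valued.v ((c * (u.val.2 - 1)) 𝔭) ≤ 1 ↔
      Valued.v (u.val.2 𝔭 - 1) ≤ 𝔭.intValuation N := by
    have h : (c * (u.val.2 - 1)) 𝔭 =
      (((N : F)⁻¹ : F) : 𝔭.adicCompletion F) * (u.val.2 𝔭 - 1) := rfl
    rw [h, map_mul, HeightOneSpectrum.valuedAdicCompletion_eq_valuation', map_inv₀,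
      HeightOneSpectrum.valuation_of_algebraMap,
      inv_mul_le_one₀ (zero_lt_iff.2 (𝔭.intValuation_ne_zero N hN))]
  have hmul (𝔭 : HeightOneSpectrum (𝓞 F)) :
      Valued.v (u.val.2 𝔭) * Valued.v ((u⁻¹).val.2 𝔭) = 1 := by
    have h : u.val.2 𝔭 * (u⁻¹).val.2 𝔭 = 1 :=
      congrArg (fun x : AdeleRing (𝓞 F) F ↦ x.2 𝔭) u.mul_inv
    rw [← map_mul, h, map_one]
  constructor
  · intro hu
    refine ⟨⟨fun 𝔭 ↦ (hu 𝔭).1.le, fun 𝔭 ↦ ?_⟩, fun 𝔭 ↦ (hcong 𝔭).2 (hu 𝔭).2⟩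
    have := hmul 𝔭
    rw [(hu 𝔭).1, one_mul] at this
    exact this.le
  · rintro ⟨⟨h1, h2⟩, h3⟩ 𝔭
    refine ⟨le_antisymm (h1 𝔭) ?_, (hcong 𝔭).1 (h3 𝔭)⟩
    rw [← hmul 𝔭]
    exact mul_le_of_le_one_right' (h2 𝔭)

/-- The elements `a`, `a⁻¹` and `(a - 1) / N` are integral at every finite prime, hence lie in `𝓞
F`. -/
theorem exists_unit_of_mem_congruenceSubgroup {N : 𝓞 F} (hN : N ≠ 0) {x : Ideles F}
    (hx : x ∈ congruenceSubgroup F N) {a : F} (ha : x.val = algebraMap F _ a) :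
    ∃ (u : (𝓞 F)ˣ) (b : 𝓞 F), (u : F) = a ∧ (u : 𝓞 F) - 1 = N * b := by
  have hN' : (N : F) ≠ 0 := by simpa using hN
  have h1 (𝔭 : HeightOneSpectrum (𝓞 F)) : 𝔭.valuation F a = 1 := by
    rw [← HeightOneSpectrum.valuedAdicCompletion_eq_valuation', ← (hx 𝔭).1, ha]
    rfl
  have h2 (𝔭 : HeightOneSpectrum (𝓞 F)) : 𝔭.valuation F ((a - 1) / N) ≤ 1 := by
    have h : 𝔭.valuation F (a - 1) ≤ 𝔭.intValuation N := by
      rw [← HeightOneSpectrum.valuedAdicCompletion_eq_valuation']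
      refine le_of_eq_of_le ?_ (hx 𝔭).2
      rw [ha]
      exact congrArg Valued.v ((algebraMap F (𝔭.adicCompletion F)).map_sub a 1 |>.trans
        (by rw [map_one]; rfl))
    rw [map_div₀, HeightOneSpectrum.valuation_of_algebraMap]
    exact div_le_one_of_le₀ h zero_le
  obtain ⟨u, hu⟩ := HeightOneSpectrum.mem_integers_of_valuation_le_one F a fun 𝔭 ↦ (h1 𝔭).le
  obtain ⟨v, hv⟩ := HeightOneSpectrum.mem_integers_of_valuation_le_one (R := 𝓞 F) F a⁻¹ fun 𝔭 ↦ by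
    rw [map_inv₀, h1, inv_one]
  obtain ⟨b, hb⟩ := HeightOneSpectrum.mem_integers_of_valuation_le_one F ((a - 1) / N) h2
  have ha0 : a ≠ 0 := by
    rintro rfl
    obtain ⟨w⟩ := (inferInstance : Nonempty (InfinitePlace F))
    have h := congrArg (fun y : AdeleRing (𝓞 F) F ↦ y.1 w) x.mul_inv
    rw [ha, map_zero, zero_mul] at h
    exact zero_ne_one h
  have huv : u * v = 1 := by
    apply RingOfIntegers.ext
    change algebraMap (𝓞 F) F (u * v) = algebraMap (𝓞 F) F 1
    rw [map_mul, hu, hv, map_one, mul_inv_cancel₀ ha0]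
  refine ⟨Units.mkOfMulEqOne u v huv, b, hu, ?_⟩
  apply RingOfIntegers.ext
  change algebraMap (𝓞 F) F (u - 1) = algebraMap (𝓞 F) F (N * b)
  rw [map_sub, map_mul, hu, hb, map_one, mul_div_cancel₀ _ hN']

theorem finiteCongruenceIdeles_subset {N : 𝓞 F} (hN : N ≠ 0) :
    finiteCongruenceIdeles (Ideal.span {N}) ⊆ congruenceSubgroup F N := by
  intro u hu 𝔭
  refine ⟨(hu.2 𝔭).1, (hu.2 𝔭).2.trans (le_of_eq ?_)⟩
  rw [HeightOneSpectrum.intValuation_if_neg _ hN]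
  rfl

theorem infiniteIncl_mem_congruenceSubgroup (N : 𝓞 F) (x : (InfiniteAdeleRing F)ˣ) :
    infiniteIncl F x ∈ congruenceSubgroup F N := fun 𝔭 ↦ by
  have h : (infiniteIncl F x).val.2 𝔭 = 1 := rfl
  simp [h]

/-- A continuous character of the idèles that is trivial on the principal idèles in an open
subgroup `H` agrees on `H` with a Hecke character. -/
theorem exists_heckeCharacter_eqOn {H : Subgroup (Ideles F)} (hH : IsOpen (H : Set (Ideles F)))
    {φ : Ideles F →* ℂˣ} (hφ : Continuous φ)
    (h1 : ∀ x ∈ H, x ∈ principalIdeles F → φ x = 1) :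
    ∃ χ : HeckeCharacter F, ∀ x ∈ H, χ (QuotientGroup.mk x) = φ x := by
  obtain ⟨g, hg⟩ := MonoidHom.exists_extension_of_rootable H (principalIdeles F) φ h1
  have hc : Continuous (g.comp (QuotientGroup.mk' (principalIdeles F))) := by
    -- A homomorphism need only be continuous at 1, and near 1 it coincides with `φ`.
    refine continuous_of_continuousAt_one _ (hφ.continuousAt.congr ?_)
    filter_upwards [hH.mem_nhds H.one_mem] with x hx
    exact (hg x hx).symm
  exact ⟨⟨g, isQuotientMap_quotient_mk'.continuous_iff.2 hc⟩, hg⟩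

end

end HeckeChar

open HeckeChar

theorem mainTheorem9 (F : Type*) [Field F] [NumberField F] [NumberField.IsCMField F]
    (n : (F →+* ℂ) → ℤ) (w : ℤ)
    (hn : ∀ τ : F →+* ℂ, n τ + n (NumberField.ComplexEmbedding.conjugate τ) = w) :
    ∃ (𝔪 : Ideal (NumberField.RingOfIntegers F)) (χ : HeckeChar.HeckeCharacter F),
      𝔪 ≠ ⊥ ∧ χ.HasModulus 𝔪 ∧ χ.HasInfinityType n := by
  have h3 : (3 : 𝓞 F) ≠ 0 := by norm_num
  obtain ⟨χ, hχ⟩ := exists_heckeCharacter_eqOn (isOpen_congruenceSubgroup h3)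
    (φ := (infinityTypeCharacter n).comp infinitePart)
    ((continuous_infinityTypeCharacter n).comp continuous_infinitePart) (by
      rintro x hx ⟨a, rfl⟩
      obtain ⟨u, b, hu, hb⟩ := exists_unit_of_mem_congruenceSubgroup h3 hx (a := a) rfl
      refine infinityTypeCharacter_eq_one hn hb ?_
      rw [hu]
      rfl)
  refine ⟨Ideal.span {3}, χ, by simp, fun u hu ↦ ?_, fun x ↦ ?_⟩
  · rw [hχ u (finiteCongruenceIdeles_subset h3 hu), MonoidHom.comp_apply,
      show infinitePart u = 1 from Units.ext hu.1, map_one]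
  · classical
    have : IsEmpty {v : InfinitePlace F // v.IsReal} :=
      ⟨fun v ↦ InfinitePlace.not_isReal_iff_isComplex.2 (IsTotallyComplex.isComplex v.1) v.2⟩
    rw [Fintype.prod_empty, one_mul, ← infinityTypeCharacter_apply]
    exact congrArg Units.val (hχ _ (infiniteIncl_mem_congruenceSubgroup 3 x))
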